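/- **Setting.** Consider $K$ arms and a true state $\theta\in\Theta\subseteq\mathbb R^d$ (possibly $\Theta=\mathbb R^d$). In state $\vartheta\in\Theta$ the rewards of arm $i$ have law $P_{\vartheta,i}$, a member of a canonical one-parameter exponential family on $\mathbb R$ attached to arm $i$, with natural parameter in the interior of the natural parameter space. Every state $\vartheta$ has a unique answer $\mathcal I(\vartheta)$. Assume $\mathrm{Alt}(\theta)=\{\vartheta\in\Theta:\mathcal I(\vartheta)\ne\mathcal I(\theta)\}=\bigcup_{x\in\mathcal X}\mathrm{Alt}_x(\theta)$ with $\mathcal X$ finite and each $\mathrm{Alt}_x(\theta)$ nonempty and convex. For $p\in\mathbb R^K_{\ge0}$ put $$D(p,x)=\inf_{\vartheta\in\mathrm{Alt}_x(\theta)}\sum_{i=1}^K p_i\,\mathrm{KL}(P_{\theta,i}\,\|\,P_{\vartheta,i}),\qquad F(p,\mu)=\sum_{x\in\mathcal X}\mu_xD(p,x).$$ Let $\Delta_K$, $\Delta_{|\mathcal X|}$ be the probability simplices. Assume that there is $M_p<\infty$ with $\|\nabla_pD(p,x)\|_\infty\le M_p$ for all $x\in\mathcal X$ and all $p\in\Delta_K$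 at which $D(\cdot,x)$ is differentiable, and that $F$ is twice continuously differentiable at every point of $\mathrm{int}(\Delta_K)\times\Delta_{|\mathcal X|}$ (relative interior). Differentiability at boundary points is understood relative to $\mathbb R^K_{\ge 0}$ (respectively $\mathbb R^K_{\ge0}\times\mathbb R^{\mathcal X}$ for $F$). Let $\mathcal D_F\subseteq\Delta_K\times\Delta_{|\mathcal X|}$ be the set of points at which $F$ is differentiable. For $(p,\mu)\in\Delta_K\times\Delta_{|\mathcal X|}$ let $$\partial_p^\circ F(p,\mu)=\mathrm{conv}\Bigl\{\lim_{n\to\infty}\nabla_pF(p^n,\mu^n):(p^n,\mu^n)\to(p,\mu),\ (p^n,\mu^n)\in\mathcal D_F\Bigr\},$$ $$\mathrm{LMO}_p(p,\mu)=\mathrm{conv}\Bigl\{q\in\Delta_K:\exists f\in\partial_p^\circ F(p,\mu),\ q\in\operatorname*{argmax}_{q'\in\Delta_K}q'^\top f\Bigr\},\qquad \mathrm{LMO}_\mu(p,\mu)=\operatorname*{argmin}_{\nu\in\Delta_{|\mathcal X|}}\nu^\top\nabla_\mu F(p,\mu),$$ $$G(p,\mu)=\bigl(\mathrm{LMO}_p(p,\mu)-p,\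 \mathrm{LMO}_\mu(p,\mu)-\mu\bigr),$$ and for $\varepsilon\ge0$, with $d(y,S)=\inf_{a\in S}\|y-a\|_1$, $$G^\varepsilon(z)=\Bigl\{y\in\mathbb R^{K+|\mathcal X|}:\exists z'\in\Delta_K\times\Delta_{|\mathcal X|},\ \|z-z'\|_1+d\bigl(y,G(z')\bigr)\le\varepsilon\Bigr\},\qquad z\in\Delta_K\times\Delta_{|\mathcal X|}.$$ For $z_0\in\Delta_K\times\Delta_{|\mathcal X|}$ let $\mathcal T^{\varepsilon,T}(z_0)$ be the set of absolutely continuous $z:[0,T]\to\Delta_K\times\Delta_{|\mathcal X|}$ with $z(0)=z_0$ and $\dot z(t)\in G^\varepsilon(z(t))$ for almost every $t\in[0,T]$. The graph of a correspondence $H$ on $\Delta_K\times\Delta_{|\mathcal X|}$ is $\{(z,y):y\in H(z)\}$. **Proposition (Graph Stability).** (i) For every $\varepsilon>0$, $\mathrm{graph}(G^\varepsilon)\subseteq\mathrm{graph}(G)+\varepsilon\mathbb B$: for every $(z,y)\in\mathrm{graph}(G^\varepsilon)$ there is $(z',y')\in\mathrm{graph}(G)$ with $\|z-z'\|_1+\|y-y'\|_1\le\varepsilon$.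 (ii) For all $\delta>0$ and $T>0$ there is $\varepsilon>0$ such that $\mathrm{graph}(\mathcal T^{\varepsilon,T})\subseteq\mathrm{graph}(\mathcal T^{0,T})+\delta\mathbb B$: for every $z_0\in\Delta_K\times\Delta_{|\mathcal X|}$ and every $z\in\mathcal T^{\varepsilon,T}(z_0)$ there are $z_0'\in\Delta_K\times\Delta_{|\mathcal X|}$ and $z'\in\mathcal T^{0,T}(z_0')$ with $\|z_0-z_0'\|_1+\sup_{t\in[0,T]}\|z(t)-z'(t)\|_1\le\delta$. -/

import Mathlib

open MeasureTheory Set Filter Topology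

noncomputable section

/-- Data of a canonical (natural) one-parameter exponential family on `ℝ`: a σ-finite reference
measure that is not concentrated on one point (so that the members of the family are in bijection
with their means). -/
structure NatExpFamily where
  base : Measure ℝ
  sigmaFinite : SigmaFinite base
  nondegenerate : ∀ c : ℝ, ¬ ∀ᵐ y ∂base, y = c

/-- The (open) natural parameter space. -/
def NatExpFamily.naturalSpace (E : NatExpFamily) : Set ℝ :=
  interior (ProbabilityTheory.integrableExpSet id E.base)

/-- The member with natural parameter `η`, of density `exp (η y - A(η))` with respect to the
reference measure. -/
def NatExpFamily.member (E : NatExpFamily) (η : ℝ) : Measure ℝ :=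
  E.base.tilted (fun y => η * y)

/-- A `K`-armed bandit model with states of nature in a subset of `ℝ^d` (possibly all of `ℝ^d`), and
a question whose unique answer at the state `ϑ` is `answer ϑ`. The reward law of arm `i` in the
state `ϑ` is the member with natural parameter `natParam ϑ i` of the exponential family of the arm
(specifying the natural parameter is the same as specifying the mean). -/
structure BanditModel (K d : ℕ) (Ans : Type*) where
  fam : Fin K → NatExpFamily
  states : Set (EuclideanSpace ℝ (Fin d))
  natParam : EuclideanSpace ℝ (Fin d) → Fin K → ℝ
  natParam_mem : ∀ ϑ ∈ states, ∀ i, natParam ϑ i ∈ (fam i).naturalSpace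
  answer : EuclideanSpace ℝ (Fin d) → Ans

namespace BanditModel

variable {K d : ℕ} {Ans : Type*}

/-- The law of the rewards of arm `i` in the state `ϑ`. -/
def law (B : BanditModel K d Ans) (ϑ : EuclideanSpace ℝ (Fin d)) (i : Fin K) : Measure ℝ :=
  (B.fam i).member (B.natParam ϑ i)

/-- `Γ(p, ϑ) = ∑ i, p i * KL(P_{θ,i} ‖ P_{ϑ,i})`, where `θ` is the true state. -/
def information (B : BanditModel K d Ans) (θ : EuclideanSpace ℝ (Fin d)) (p : Fin K → ℝ)
    (ϑ : EuclideanSpace ℝ (Fin d)) : ℝ :=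
  ∑ i, p i * (InformationTheory.klDiv (B.law θ i) (B.law ϑ i)).toReal

/-- The alternative set: the states with an answer different from that of `θ`. -/
def altSet (B : BanditModel K d Ans) (θ : EuclideanSpace ℝ (Fin d)) :
    Set (EuclideanSpace ℝ (Fin d)) :=
  {ϑ | ϑ ∈ B.states ∧ B.answer ϑ ≠ B.answer θ}

/-- The alternative set at `θ` is the union of finitely many (nonempty) convex sets `alt x`. -/
structure AltDecomposition (B : BanditModel K d Ans) (θ : EuclideanSpace ℝ (Fin d))
    (X : Type*) [Fintype X] where
  alt : X → Set (EuclideanSpace ℝ (Fin d))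
  alt_nonempty : ∀ x, (alt x).Nonempty
  alt_convex : ∀ x, Convex ℝ (alt x)
  altSet_eq : B.altSet θ = ⋃ x, alt x

/-- `D(p, x) = inf_{ϑ ∈ Alt_x(θ)} Γ(p, ϑ)` (meaningful for `p` in the nonnegative orthant). -/
def scenarioPayoff {X : Type*} [Fintype X] (B : BanditModel K d Ans)
    (θ : EuclideanSpace ℝ (Fin d)) (A : B.AltDecomposition θ X) (p : Fin K → ℝ) (x : X) : ℝ :=
  sInf (B.information θ p '' A.alt x)

end BanditModel

namespace SelfPlay

variable {K : ℕ} {X : Type*} [Fintype X] [DecidableEq X]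

/-- The nonnegative orthant of `ℝ^K`. -/
def orthant (K : ℕ) : Set (Fin K → ℝ) := {p | ∀ i, 0 ≤ p i}

/-- `Δ_K × Δ_X`. -/
def stateSpace (K : ℕ) (X : Type*) [Fintype X] : Set ((Fin K → ℝ) × (X → ℝ)) :=
  stdSimplex ℝ (Fin K) ×ˢ stdSimplex ℝ X

/-- The mixed payoff `F(p, μ) = ∑ x, μ x * D(p, x)`. -/
def payoff (D : (Fin K → ℝ) → X → ℝ) (z : (Fin K → ℝ) × (X → ℝ)) : ℝ :=
  ∑ x, z.2 x * D z.1 x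

/-- The gradients of `D(·, x)` at those points of the simplex at which `D(·, x)` is differentiable
(as a function on the nonnegative orthant, which is where it is defined) are bounded in the
sup norm, uniformly in the points and in `x`. -/
def BoundedGradients (D : (Fin K → ℝ) → X → ℝ) : Prop :=
  ∃ M : ℝ, ∀ x : X, ∀ p ∈ stdSimplex ℝ (Fin K),
    DifferentiableWithinAt ℝ (fun p' => D p' x) (orthant K) p →
      ∀ i, |fderivWithin ℝ (fun p' => D p' x) (orthant K) p (Pi.single i 1)| ≤ M

/-- `F` is twice continuously differentiable at the points of `int Δ_K × Δ_X`, with the relative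
interior of the simplex `Δ_K`. -/
def SmoothInside (D : (Fin K → ℝ) → X → ℝ) : Prop :=
  ∀ z ∈ stateSpace K X, (∀ i, 0 < z.1 i) → ContDiffAt ℝ 2 (payoff D) z

/-- The set of the points of `Δ_K × Δ_X` at which `F` is differentiable, as a function on the
product of the nonnegative orthant of `ℝ^K` with `ℝ^X`. -/
def diffSet (D : (Fin K → ℝ) → X → ℝ) : Set ((Fin K → ℝ) × (X → ℝ)) :=
  {z | z ∈ stateSpace K X ∧ DifferentiableWithinAt ℝ (payoff D) (orthant K ×ˢ univ) z}

/-- `∇_p F(p, μ)`. -/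
def gradP (D : (Fin K → ℝ) → X → ℝ) (z : (Fin K → ℝ) × (X → ℝ)) : Fin K → ℝ :=
  fun i => fderivWithin ℝ (payoff D) (orthant K ×ˢ univ) z (Pi.single i 1, 0)

/-- `∇_μ F(p, μ)`. -/
def gradMu (D : (Fin K → ℝ) → X → ℝ) (z : (Fin K → ℝ) × (X → ℝ)) : X → ℝ :=
  fun x => fderiv ℝ (fun ν : X → ℝ => payoff D (z.1, ν)) z.2 (Pi.single x 1)

/-- The Clarke generalized gradient of `F` in `p`: the convex hull of the limits of the gradients
`∇_p F(p^n, μ^n)` along the sequences of points of differentiability that tend to `(p, μ)`. -/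
def clarkeP (D : (Fin K → ℝ) → X → ℝ) (z : (Fin K → ℝ) × (X → ℝ)) : Set (Fin K → ℝ) :=
  convexHull ℝ {f | ∃ u : ℕ → (Fin K → ℝ) × (X → ℝ), (∀ n, u n ∈ diffSet D) ∧
    Tendsto u atTop (𝓝 z) ∧ Tendsto (fun n => gradP D (u n)) atTop (𝓝 f)}

/-- The linear oracle of the maximizer. -/
def lmoP (D : (Fin K → ℝ) → X → ℝ) (z : (Fin K → ℝ) × (X → ℝ)) : Set (Fin K → ℝ) :=
  convexHull ℝ {q | q ∈ stdSimplex ℝ (Fin K) ∧ ∃ f ∈ clarkeP D z,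
    ∀ q' ∈ stdSimplex ℝ (Fin K), q' ⬝ᵥ f ≤ q ⬝ᵥ f}

/-- The linear oracle of the minimizer. -/
def lmoMu (D : (Fin K → ℝ) → X → ℝ) (z : (Fin K → ℝ) × (X → ℝ)) : Set (X → ℝ) :=
  {ν | ν ∈ stdSimplex ℝ X ∧ ∀ ν' ∈ stdSimplex ℝ X, ν ⬝ᵥ gradMu D z ≤ ν' ⬝ᵥ gradMu D z}

/-- The drift `G(p, μ) = (LMO_p(p, μ) - p, LMO_μ(p, μ) - μ)`. -/
def drift (D : (Fin K → ℝ) → X → ℝ) (z : (Fin K → ℝ) × (X → ℝ)) :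
    Set ((Fin K → ℝ) × (X → ℝ)) :=
  {y | ∃ q ∈ lmoP D z, ∃ ν ∈ lmoMu D z, y = (q - z.1, ν - z.2)}

/-- The `ℓ¹` norm on `ℝ^K × ℝ^X = ℝ^{K+|X|}`. -/
def l1 (v : (Fin K → ℝ) × (X → ℝ)) : ℝ := ∑ i, |v.1 i| + ∑ x, |v.2 x|

/-- The `ℓ¹` distance from a point to a set (`∞` if the set is empty). -/
def l1Dist (y : (Fin K → ℝ) × (X → ℝ)) (S : Set ((Fin K → ℝ) × (X → ℝ))) : ENNReal :=
  ⨅ a ∈ S, ENNReal.ofReal (l1 (y - a))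

/-- The `ε`-perturbed drift `G^ε` (for `ε ≥ 0`). -/
def perturbedDrift (D : (Fin K → ℝ) → X → ℝ) (ε : ℝ) (z : (Fin K → ℝ) × (X → ℝ)) :
    Set ((Fin K → ℝ) × (X → ℝ)) :=
  {y | ∃ z' ∈ stateSpace K X,
    ENNReal.ofReal (l1 (z - z')) + l1Dist y (drift D z') ≤ ENNReal.ofReal ε}

/-- The graph of a correspondence defined on `Δ_K × Δ_X`. -/
def graph {Y : Type*} (H : (Fin K → ℝ) × (X → ℝ) → Set Y) : Set (((Fin K → ℝ) × (X → ℝ)) × Y) :=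
  {w | w.1 ∈ stateSpace K X ∧ w.2 ∈ H w.1}

/-- `𝒯^{ε,T}(z₀)`: the absolutely continuous paths in `Δ_K × Δ_X` on `[0, T]` that start at `z₀` and
solve the `ε`-perturbed inclusion (the values of `z` outside `[0, T]` are irrelevant, and absolute
continuity does not depend on the choice of the norm). -/
def solutions (D : (Fin K → ℝ) → X → ℝ) (ε T : ℝ) (z₀ : (Fin K → ℝ) × (X → ℝ)) :
    Set (ℝ → (Fin K → ℝ) × (X → ℝ)) :=
  {z | z 0 = z₀ ∧ (∀ t ∈ Icc 0 T, z t ∈ stateSpace K X) ∧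
    AbsolutelyContinuousOnInterval z 0 T ∧
    ∀ᵐ t ∂(volume.restrict (Icc 0 T)), ∃ y ∈ perturbedDrift D ε (z t), HasDerivAt z y t}

end SelfPlay

end

/-!
Each `D(·, x)` is an infimum of nonnegative linear functionals, hence a superlinear function on the
orthant. A gradient of a superlinear function is a linear majorant that touches it along the whole
ray through the point of differentiability, so the bound on the gradients at positive points makes
`D(·, x)` Lipschitz there, and upper semicontinuity carries this to the boundary. Therefore the
gradients of `F` are bounded, and the graphs of the Clarke gradient, of the two linear oracles and
of the drift `G` are compact, with convex values in the case of `G`.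

Part (i) holds because the infimum defining `d(y, G(z'))` is attained. Part (ii) is the stability of
a differential inclusion whose right-hand side has a compact graph and convex values: by
Hahn–Banach, the slope of an absolutely continuous path between two times lies in every closed
convex set containing the velocities in between, so a uniform limit of solutions for perturbations
tending to zero, which exists along a subsequence by Arzelà–Ascoli, solves the limit inclusion.
-/

section CompactRelation

variable {α β : Type*}

section Topological

variable [TopologicalSpace α] [TopologicalSpace β] {Γ : Set (α × β)}

theorem isCompact_prodMk_preimage [T1Space α] (hΓ : IsCompact Γ) (a : α) :
    IsCompact (Prod.mk a ⁻¹' Γ) := by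
  have hfiber : Prod.mk a ⁻¹' Γ = Prod.snd '' (Γ ∩ Prod.fst ⁻¹' {a}) := by
    ext b
    simp
  rw [hfiber]
  exact (hΓ.inter_right (isClosed_singleton.preimage continuous_fst)).image continuous_snd

theorem upperHemicontinuous_prodMk_preimage [T2Space α] (hΓ : IsCompact Γ) :
    UpperHemicontinuous fun a => Prod.mk a ⁻¹' Γ := by
  refine .of_forall_isOpen fun a U hU haU => ?_
  have hclosed : IsClosed (Prod.fst '' (Γ \ Prod.snd ⁻¹' U)) :=
    ((hΓ.diff (hU.preimage continuous_snd)).image continuous_fst).isClosed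
  have ha : a ∉ Prod.fst '' (Γ \ Prod.snd ⁻¹' U) := by
    rintro ⟨⟨_, b⟩, ⟨hb, hbU⟩, rfl⟩
    exact hbU (haU hb)
  filter_upwards [hclosed.isOpen_compl.mem_nhds ha] with a' ha' b hb
  by_contra hbU
  exact ha' ⟨(a', b), ⟨hb, hbU⟩, rfl⟩

theorem isClosed_graph_of_upperHemicontinuous [RegularSpace β] {f : α → Set β}
    (hf : UpperHemicontinuous f) (hclosed : ∀ a, IsClosed (f a)) :
    IsClosed {w : α × β | w.2 ∈ f w.1} :=
  isClosed_iff_frequently.2 fun w hw =>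
    (hf.upperHemicontinuousAt w.1).mem_of_tendsto (hclosed w.1) continuousAt_fst hw continuousAt_snd

end Topological

theorem exists_prodMk_preimage_cthickening_subset [MetricSpace α] [MetricSpace β]
    {Γ : Set (α × β)} (hΓ : IsCompact Γ) (a : α) {η : ℝ} (hη : 0 < η) :
    ∃ r > 0, ∀ a', dist a' a < r →
      Prod.mk a' ⁻¹' Metric.cthickening r Γ ⊆ Metric.cthickening η (Prod.mk a ⁻¹' Γ) := by
  obtain ⟨ρ, hρ, hball⟩ := Metric.eventually_nhds_iff.1 <|
    (upperHemicontinuous_prodMk_preimage hΓ).forall_isOpen a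
      (Metric.thickening (η / 2) (Prod.mk a ⁻¹' Γ)) Metric.isOpen_thickening
      (Metric.self_subset_thickening (half_pos hη) _)
  refine ⟨min (ρ / 2) (η / 2), by positivity, fun a' ha' b hb => ?_⟩
  rw [mem_preimage, hΓ.cthickening_eq_biUnion_closedBall (by positivity)] at hb
  obtain ⟨⟨c, d⟩, hcd, hdist⟩ := mem_iUnion₂.1 hb
  obtain ⟨hac, hbd⟩ := max_le_iff.1 (Metric.mem_closedBall.1 hdist)
  have hc : dist c a < ρ := by
    have := dist_triangle_left c a a'
    linarith [min_le_left (ρ / 2) (η / 2)]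
  obtain ⟨e, he, hde⟩ := Metric.mem_thickening_iff.1 (hball hc hcd)
  refine Metric.mem_cthickening_of_dist_le b e η _ he ((dist_triangle b d e).trans ?_)
  linarith [min_le_right (ρ / 2) (η / 2)]

section ConvexHull

variable {F : Type*} [NormedAddCommGroup F] [NormedSpace ℝ F] [FiniteDimensional ℝ F]

theorem convexHull_eq_biUnion_image_stdSimplex_prod_pi (s : Set F) :
    convexHull ℝ s = ⋃ n ∈ Finset.range (Module.finrank ℝ F + 2),
      (fun a : (Fin n → ℝ) × (Fin n → F) => ∑ i, a.1 i • a.2 i) ''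
        (stdSimplex ℝ (Fin n) ×ˢ univ.pi fun _ => s) := by
  refine Subset.antisymm (fun y hy => ?_) (iUnion₂_subset fun n _ => ?_)
  · obtain ⟨ι, _, v, w, hv, hindep, hw, hw1, rfl⟩ := eq_pos_convex_span_of_mem_convexHull hy
    let e := Fintype.equivFin ι
    have hcard : Fintype.card ι < Module.finrank ℝ F + 2 := by
      have := hindep.card_le_finrank_succ
      have := (vectorSpan ℝ (range v)).finrank_le
      omega
    exact mem_biUnion (Finset.mem_coe.2 (Finset.mem_range.2 hcard))
      ⟨(w ∘ e.symm, v ∘ e.symm),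
        ⟨⟨fun i => (hw _).le, (e.symm.sum_comp w).trans hw1⟩, fun i _ => hv ⟨_, rfl⟩⟩,
        e.symm.sum_comp fun i => w i • v i⟩
  · rintro _ ⟨⟨w, v⟩, ⟨hw, hv⟩, rfl⟩
    exact (convex_convexHull ℝ s).sum_mem (fun i _ => hw.1 i) hw.2
      fun i _ => subset_convexHull ℝ s (hv i (mem_univ i))

theorem isCompact_convexHull {s : Set F} (hs : IsCompact s) : IsCompact (convexHull ℝ s) := by
  rw [convexHull_eq_biUnion_image_stdSimplex_prod_pi]
  exact (Finset.range _).isCompact_biUnion fun n _ =>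
    ((isCompact_stdSimplex ℝ (Fin n)).prod (isCompact_univ_pi fun _ => hs)).image (by fun_prop)

theorem upperHemicontinuous_convexHull [TopologicalSpace α] {f : α → Set F}
    (hf : UpperHemicontinuous f) (hcompact : ∀ a, IsCompact (f a)) :
    UpperHemicontinuous fun a => convexHull ℝ (f a) := by
  refine .of_forall_isOpen fun a U hU haU => ?_
  obtain ⟨δ, hδ, hδU⟩ := (isCompact_convexHull (hcompact a)).exists_thickening_subset_open hU haU
  have hsubset : f a ⊆ Metric.thickening δ (convexHull ℝ (f a)) :=
    (subset_convexHull ℝ _).trans (Metric.self_subset_thickening hδ _)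
  filter_upwards [hf.forall_isOpen a _ Metric.isOpen_thickening hsubset] with a' ha'
  exact (convexHull_min ha' ((convex_convexHull ℝ _).thickening δ)).trans hδU

theorem isCompact_graph_convexHull [TopologicalSpace α] [T2Space α] {Γ : Set (α × F)}
    (hΓ : IsCompact Γ) : IsCompact {w : α × F | w.2 ∈ convexHull ℝ (Prod.mk w.1 ⁻¹' Γ)} := by
  have hsection := isCompact_prodMk_preimage hΓ
  refine ((hΓ.image continuous_fst).prod
    (isCompact_convexHull (hΓ.image continuous_snd))).of_isClosed_subset ?_ ?_
  · exact isClosed_graph_of_upperHemicontinuous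
      (upperHemicontinuous_convexHull (upperHemicontinuous_prodMk_preimage hΓ) hsection)
      fun a => (isCompact_convexHull (hsection a)).isClosed
  · rintro ⟨a, b⟩ (hb : b ∈ convexHull ℝ (Prod.mk a ⁻¹' Γ))
    obtain ⟨c, hc⟩ := convexHull_nonempty_iff.1 (nonempty_of_mem hb)
    have hsubset : Prod.mk a ⁻¹' Γ ⊆ Prod.snd '' Γ := fun d hd => ⟨(a, d), hd, rfl⟩
    exact ⟨⟨(a, c), hc, rfl⟩, convexHull_mono hsubset hb⟩

end ConvexHull

end CompactRelation

section LinearArgmax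

variable {ι : Type*} [Fintype ι]

/-- The maximizers over `C` of the linear functional with coefficients `f`: the face of `C` exposed
by `f`. This is the linear maximization oracle with feasible set `C`. -/
def linearArgmax (C : Set (ι → ℝ)) (f : ι → ℝ) : Set (ι → ℝ) :=
  {q | q ∈ C ∧ ∀ q' ∈ C, q' ⬝ᵥ f ≤ q ⬝ᵥ f}

variable {C : Set (ι → ℝ)}

theorem convex_linearArgmax (hC : Convex ℝ C) (f : ι → ℝ) : Convex ℝ (linearArgmax C f) := by
  have hface : linearArgmax C f = C ∩ ⋂ q' ∈ C, {q | q' ⬝ᵥ f ≤ q ⬝ᵥ f} := by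
    ext q
    simp [linearArgmax]
  have hlinear : IsLinearMap ℝ fun q : ι → ℝ => q ⬝ᵥ f :=
    ⟨fun p q => add_dotProduct p q f, fun c q => smul_dotProduct c q f⟩
  rw [hface]
  exact hC.inter (convex_iInter₂ fun q' _ => convex_halfSpace_ge hlinear _)

theorem isClosed_graph_linearArgmax (hC : IsClosed C) :
    IsClosed {w : (ι → ℝ) × (ι → ℝ) | w.2 ∈ linearArgmax C w.1} := by
  have hgraph : {w : (ι → ℝ) × (ι → ℝ) | w.2 ∈ linearArgmax C w.1} =
      Prod.snd ⁻¹' C ∩ ⋂ q' ∈ C, {w | q' ⬝ᵥ w.1 ≤ w.2 ⬝ᵥ w.1} := by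
    ext w
    simp [linearArgmax]
  rw [hgraph]
  exact (hC.preimage continuous_snd).inter
    (isClosed_biInter fun q' _ => isClosed_le (by fun_prop) (by fun_prop))

theorem isCompact_graph_linearArgmax_comp {α : Type*} [TopologicalSpace α]
    {R : Set (α × (ι → ℝ))} (hR : IsCompact R) (hC : IsCompact C) :
    IsCompact {w : α × (ι → ℝ) | ∃ f, (w.1, f) ∈ R ∧ w.2 ∈ linearArgmax C f} := by
  have hcompact : IsCompact ((R ×ˢ C) ∩
      (fun u => (u.1.2, u.2)) ⁻¹' {w : (ι → ℝ) × (ι → ℝ) | w.2 ∈ linearArgmax C w.1}) :=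
    (hR.prod hC).inter_right ((isClosed_graph_linearArgmax hC.isClosed).preimage (by fun_prop))
  convert hcompact.image (f := fun u : (α × (ι → ℝ)) × (ι → ℝ) => (u.1.1, u.2)) (by fun_prop)
  ext ⟨a, q⟩
  constructor
  · rintro ⟨f, hf, hq⟩
    exact ⟨((a, f), q), ⟨⟨hf, hq.1⟩, hq⟩, rfl⟩
  · rintro ⟨⟨⟨a, f⟩, q⟩, ⟨⟨hf, -⟩, hq⟩, ⟨⟩⟩
    exact ⟨f, hf, hq⟩

end LinearArgmax

theorem exists_subseq_tendstoUniformlyOn_of_lipschitzOnWith {α β : Type*} [PseudoMetricSpace α]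
    [MetricSpace β] {K : Set α} {S : Set β} {L : NNReal} {f : ℕ → α → β} (hK : IsCompact K)
    (hS : IsCompact S) (hf : ∀ n, LipschitzOnWith L (f n) K) (hfS : ∀ n, MapsTo (f n) K S) :
    ∃ (φ : ℕ → ℕ) (g : α → β), StrictMono φ ∧ LipschitzOnWith L g K ∧ MapsTo g K S ∧
      TendstoUniformlyOn (fun n => f (φ n)) g atTop K := by
  have : CompactSpace K := isCompact_iff_compactSpace.1 hK
  let A : Set C(K, β) := {u | LipschitzWith L u ∧ ∀ s, u s ∈ S}
  have himage : ContinuousMap.toFun '' A =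
      (univ.pi fun _ => S) ∩ {u : K → β | LipschitzWith L u} := by
    ext u
    constructor
    · rintro ⟨v, hv, rfl⟩
      exact ⟨fun s _ => hv.2 s, hv.1⟩
    · exact fun hu => ⟨⟨u, hu.2.continuous⟩, ⟨hu.2, fun s => hu.1 s (mem_univ s)⟩, rfl⟩
  have hA : IsCompact A := by
    refine ArzelaAscoli.isCompact_of_equicontinuous A ?_
      (LipschitzWith.uniformEquicontinuous _ L fun u => u.2.1).equicontinuous
    rw [himage]
    exact (isCompact_univ_pi fun _ => hS).inter_right (isClosed_setOfPred_lipschitzWith L)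
  let F : ℕ → C(K, β) := fun n => ⟨K.domRestrict (f n), (hf n).to_restrict.continuous⟩
  obtain ⟨u, hu, φ, hφ, hlim⟩ := hA.tendsto_subseq (x := F) fun n =>
    ⟨(hf n).to_restrict, fun s => hfS n s.2⟩
  let g : α → β := Function.extend Subtype.val u (f 0)
  have hg : g ∘ Subtype.val = u := Function.extend_comp Subtype.val_injective u (f 0)
  refine ⟨φ, g, hφ, ?_, ?_, ?_⟩
  · rw [lipschitzOnWith_iff_restrict, domRestrict_eq, hg]
    exact hu.1
  · exact fun s hs => mem_of_eq_of_mem (congrFun hg ⟨s, hs⟩) (hu.2 ⟨s, hs⟩)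
  · rw [tendstoUniformlyOn_iff_tendstoUniformly_comp_coe, hg]
    exact ContinuousMap.tendsto_iff_tendstoUniformly.1 hlim

section DifferentialInclusion

variable {E : Type*} [NormedAddCommGroup E] [NormedSpace ℝ E]

theorem slope_mem_of_ae_hasDerivAt {z : ℝ → E} {a b : ℝ} {C : Set E} (hab : a < b)
    (hz : AbsolutelyContinuousOnInterval z a b) (hC : Convex ℝ C) (hclosed : IsClosed C)
    (hderiv : ∀ᵐ t, t ∈ Icc a b → ∃ y ∈ C, HasDerivAt z y t) : slope z a b ∈ C := by
  by_contra hslope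
  obtain ⟨f, u, hfu, hfC⟩ := geometric_hahn_banach_point_closed hC hclosed hslope
  have hf : AbsolutelyContinuousOnInterval (fun t => f (z t)) a b := by
    refine squeeze_zero (fun t => by positivity) (fun t => ?_)
      (by simpa using Tendsto.const_mul ‖f‖ hz)
    rw [Finset.mul_sum]
    gcongr
    exact f.lipschitz.dist_le_mul _ _
  have hderiv_ge : ∀ᵐ t ∂volume.restrict (Icc a b), u ≤ deriv (fun t => f (z t)) t := by
    rw [ae_restrict_iff' measurableSet_Icc]
    filter_upwards [hderiv] with t ht htab
    obtain ⟨y, hy, hzy⟩ := ht htab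
    have hfy : deriv (fun t => f (z t)) t = f y := (f.hasFDerivAt.comp_hasDerivAt t hzy).deriv
    exact hfy ▸ (hfC y hy).le
  have hincrement : (b - a) * u ≤ f (z b - z a) := by
    simpa [hf.integral_deriv_eq_sub] using intervalIntegral.integral_mono_ae_restrict hab.le
      (intervalIntegrable_const (c := u)) hf.intervalIntegrable_deriv hderiv_ge
  rw [slope_def_module, map_smul, smul_eq_mul, inv_mul_lt_iff₀ (sub_pos.2 hab)] at hfu
  exact hfu.not_ge hincrement

/-- Solutions on `[a, b]`, constrained to `S`, of the differential inclusion
`z' t ∈ {y | (z t, y) ∈ Γ}`. The right-hand side is given by its graph `Γ`, so that perturbing the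
inclusion amounts to thickening `Γ`. -/
structure IsInclusionSolution (Γ : Set (E × E)) (S : Set E) (a b : ℝ) (z : ℝ → E) : Prop where
  mapsTo : MapsTo z (Icc a b) S
  absolutelyContinuous : AbsolutelyContinuousOnInterval z a b
  exists_hasDerivAt : ∀ᵐ t, t ∈ Icc a b → ∃ y, (z t, y) ∈ Γ ∧ HasDerivAt z y t

namespace IsInclusionSolution

variable {Γ : Set (E × E)} {S : Set E} {a b : ℝ} {z : ℝ → E}

theorem slope_mem (hz : IsInclusionSolution Γ S a b z) {s t : ℝ} (has : a ≤ s) (hst : s < t)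
    (htb : t ≤ b) {C : Set E} (hC : Convex ℝ C) (hclosed : IsClosed C)
    (hsub : ∀ u ∈ Icc s t, Prod.mk (z u) ⁻¹' Γ ⊆ C) : slope z s t ∈ C := by
  have hIcc : Icc s t ⊆ Icc a b := Icc_subset_Icc has htb
  refine slope_mem_of_ae_hasDerivAt hst (hz.absolutelyContinuous.mono ?_) hC hclosed ?_
  · rwa [uIcc_of_le hst.le, uIcc_of_le (has.trans (hst.le.trans htb))]
  · filter_upwards [hz.exists_hasDerivAt] with u hu hust
    obtain ⟨y, hy, hzy⟩ := hu (hIcc hust)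
    exact ⟨y, hsub u hust hy, hzy⟩

theorem lipschitzOnWith (hz : IsInclusionSolution Γ S a b z) {L : NNReal}
    (hΓ : ∀ w ∈ Γ, ‖w.2‖ ≤ L) : LipschitzOnWith L z (Icc a b) := by
  refine LipschitzOnWith.of_dist_le_mul fun t ht s hs => ?_
  wlog hst : s < t generalizing s t
  · obtain rfl | hts := (not_lt.1 hst).eq_or_lt
    · simp
    · rw [dist_comm, dist_comm t]
      exact this s hs t ht hts
  have hslope : slope z s t ∈ Metric.closedBall 0 L :=
    hz.slope_mem hs.1 hst ht.2 (convex_closedBall 0 _) Metric.isClosed_closedBall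
      fun u _ y hy => mem_closedBall_zero_iff.2 (hΓ _ hy)
  have hpos : 0 < t - s := sub_pos.2 hst
  rw [mem_closedBall_zero_iff, slope_def_module, norm_smul, norm_inv, Real.norm_of_nonneg hpos.le,
    inv_mul_le_iff₀ hpos] at hslope
  rwa [dist_eq_norm, Real.dist_eq, abs_of_pos hpos, mul_comm]

end IsInclusionSolution

section Limits

variable {Γ : Set (E × E)} {S : Set E} {a b : ℝ} {ε : ℕ → ℝ} {z : ℕ → ℝ → E} {g : ℝ → E}

theorem eventually_slope_mem_cthickening (hΓ : IsCompact Γ)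
    (hconvex : ∀ p, Convex ℝ (Prod.mk p ⁻¹' Γ)) (hε : Tendsto ε atTop (𝓝 0))
    (hz : ∀ n, IsInclusionSolution (Metric.cthickening (ε n) Γ) S a b (z n))
    (hzg : TendstoUniformlyOn z g atTop (Icc a b)) {t : ℝ} (ht : t ∈ Ioo a b)
    (hg : ContinuousAt g t) {η : ℝ} (hη : 0 < η) :
    ∀ᶠ s in 𝓝[>] t, slope g t s ∈ Metric.cthickening η (Prod.mk (g t) ⁻¹' Γ) := by
  obtain ⟨r, hr, hsub⟩ := exists_prodMk_preimage_cthickening_subset hΓ (g t) hη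
  obtain ⟨ρ, hρ, hgρ⟩ := Metric.continuousAt_iff.1 hg (r / 2) (half_pos hr)
  filter_upwards [Ioo_mem_nhdsGT (lt_min ht.2 (lt_add_of_pos_right t hρ))] with s hs
  obtain ⟨hsb, hsρ⟩ := lt_min_iff.1 hs.2
  have hlim : Tendsto (fun n => slope (z n) t s) atTop (𝓝 (slope g t s)) := by
    simp only [slope_def_module]
    exact ((hzg.tendsto_at ⟨ht.1.le.trans hs.1.le, hsb.le⟩).sub
      (hzg.tendsto_at ⟨ht.1.le, ht.2.le⟩)).const_smul _
  refine Metric.isClosed_cthickening.mem_of_tendsto hlim ?_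
  filter_upwards [hε.eventually_lt_const hr,
    Metric.tendstoUniformlyOn_iff.1 hzg (r / 2) (half_pos hr)] with n hεr hzr
  refine (hz n).slope_mem ht.1.le hs.1 hsb.le ((hconvex _).cthickening η)
    Metric.isClosed_cthickening fun u hu => ?_
  have hzu : dist (z n u) (g u) < r / 2 := by
    rw [dist_comm]
    exact hzr u ⟨ht.1.le.trans hu.1, hu.2.trans hsb.le⟩
  have hgu : dist (g u) (g t) < r / 2 := by
    refine hgρ ?_
    rw [Real.dist_eq, abs_of_nonneg (sub_nonneg.2 hu.1)]
    linarith [hu.2]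
  exact (preimage_mono (Metric.cthickening_mono hεr.le Γ)).trans
    (hsub _ (by linarith [dist_triangle (z n u) (g u) (g t)]))

theorem prodMk_mem_of_hasDerivAt_of_tendsto (hΓ : IsCompact Γ)
    (hconvex : ∀ p, Convex ℝ (Prod.mk p ⁻¹' Γ)) (hε : Tendsto ε atTop (𝓝 0))
    (hz : ∀ n, IsInclusionSolution (Metric.cthickening (ε n) Γ) S a b (z n))
    (hzg : TendstoUniformlyOn z g atTop (Icc a b)) {t : ℝ} (ht : t ∈ Ioo a b) {y : E}
    (hy : HasDerivAt g y t) : (g t, y) ∈ Γ := by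
  have hslope : Tendsto (slope g t) (𝓝[>] t) (𝓝 y) :=
    (hasDerivAt_iff_tendsto_slope.1 hy).mono_left (nhdsGT_le_nhdsNE t)
  rw [← mem_preimage, ← (isCompact_prodMk_preimage hΓ (g t)).isClosed.closure_eq,
    Metric.closure_eq_iInter_cthickening]
  exact mem_iInter₂.2 fun η hη => Metric.isClosed_cthickening.mem_of_tendsto hslope
    (eventually_slope_mem_cthickening hΓ hconvex hε hz hzg ht hy.continuousAt hη)

variable [FiniteDimensional ℝ E]

theorem exists_subseq_tendstoUniformlyOn_isInclusionSolution (hΓ : IsCompact Γ)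
    (hconvex : ∀ p, Convex ℝ (Prod.mk p ⁻¹' Γ)) (hS : IsCompact S) (hab : a ≤ b)
    (hε : Tendsto ε atTop (𝓝 0))
    (hz : ∀ n, IsInclusionSolution (Metric.cthickening (ε n) Γ) S a b (z n)) :
    ∃ (φ : ℕ → ℕ) (g : ℝ → E), StrictMono φ ∧ IsInclusionSolution Γ S a b g ∧
      TendstoUniformlyOn (fun n => z (φ n)) g atTop (Icc a b) := by
  obtain ⟨r, hr⟩ := hε.bddAbove_range
  obtain ⟨L, hL⟩ := (hΓ.isBounded.cthickening (δ := r)).exists_norm_le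
  have hlip : ∀ n, LipschitzOnWith L.toNNReal (z n) (Icc a b) := fun n =>
    (hz n).lipschitzOnWith fun w hw => (norm_snd_le w).trans <|
      (hL w (Metric.cthickening_mono (hr ⟨n, rfl⟩) Γ hw)).trans (Real.le_coe_toNNReal L)
  obtain ⟨φ, g, hφ, hg, hgS, hlim⟩ := exists_subseq_tendstoUniformlyOn_of_lipschitzOnWith
    isCompact_Icc hS hlip fun n => (hz n).mapsTo
  refine ⟨φ, g, hφ, ⟨hgS, ?_, ?_⟩, hlim⟩
  · exact LipschitzOnWith.absolutelyContinuousOnInterval (by rwa [uIcc_of_le hab])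
  · rw [← ae_restrict_iff' measurableSet_Icc, ← restrict_Ioo_eq_restrict_Icc,
      ae_restrict_iff' measurableSet_Ioo]
    filter_upwards [hg.ae_differentiableWithinAt_of_mem_real] with t hdiff ht
    have hderiv := ((hdiff (Ioo_subset_Icc_self ht)).differentiableAt
      (Icc_mem_nhds ht.1 ht.2)).hasDerivAt
    exact ⟨deriv g t, prodMk_mem_of_hasDerivAt_of_tendsto hΓ hconvex
      (hε.comp hφ.tendsto_atTop) (fun n => hz (φ n)) hlim ht hderiv, hderiv⟩

theorem exists_isInclusionSolution_dist_lt_of_cthickening (hΓ : IsCompact Γ)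
    (hconvex : ∀ p, Convex ℝ (Prod.mk p ⁻¹' Γ)) (hS : IsCompact S) (hab : a ≤ b) {δ : ℝ}
    (hδ : 0 < δ) :
    ∃ ε > 0, ∀ z, IsInclusionSolution (Metric.cthickening ε Γ) S a b z →
      ∃ g, IsInclusionSolution Γ S a b g ∧ ∀ t ∈ Icc a b, dist (z t) (g t) < δ := by
  by_contra! h
  choose z hz hfar using fun n : ℕ => h (1 / ((n : ℝ) + 1)) Nat.one_div_pos_of_nat
  obtain ⟨φ, g, -, hg, hlim⟩ := exists_subseq_tendstoUniformlyOn_isInclusionSolution hΓ hconvex hS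
    hab tendsto_one_div_add_atTop_nhds_zero_nat hz
  obtain ⟨n, hn⟩ := (Metric.tendstoUniformlyOn_iff.1 hlim δ hδ).exists
  obtain ⟨t, ht, hdist⟩ := hfar (φ n) g hg
  exact hdist.not_gt (dist_comm (g t) _ ▸ hn t ht)

end Limits

end DifferentialInclusion

theorem tendsto_slope_ray_of_hasFDerivWithinAt {E F : Type*} [NormedAddCommGroup E]
    [NormedSpace ℝ E] [NormedAddCommGroup F] [NormedSpace ℝ F] {f : E → F} {f' : E →L[ℝ] F}
    {s : Set E} {p v : E} (hf : HasFDerivWithinAt f f' s p)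
    (hv : ∀ t : ℝ, 0 < t → p + t • v ∈ s) :
    Tendsto (fun t : ℝ => t⁻¹ • (f (p + t • v) - f p)) (𝓝[>] 0) (𝓝 (f' v)) := by
  have hline : HasDerivWithinAt (fun t : ℝ => f (p + t • v)) (f' v) (Ioi 0) 0 :=
    HasDerivWithinAt.mono (hf.hasLineDerivWithinAt v) fun t ht => hv t ht
  rw [hasDerivWithinAt_iff_tendsto_slope' self_notMem_Ioi] at hline
  exact hline.congr fun t => by simp [slope_def_module]

/-- `f` is a superlinear function on the convex cone `s`: positively homogeneous and superadditive.
The cone need not contain the origin. -/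
structure SuperlinearOn {E : Type*} [AddCommGroup E] [Module ℝ E] (s : Set E) (f : E → ℝ) :
    Prop where
  smul_mem : ∀ ⦃c : ℝ⦄, 0 < c → ∀ ⦃p⦄, p ∈ s → c • p ∈ s
  add_mem : ∀ ⦃p⦄, p ∈ s → ∀ ⦃q⦄, q ∈ s → p + q ∈ s
  apply_smul : ∀ ⦃c : ℝ⦄, 0 < c → ∀ ⦃p⦄, p ∈ s → f (c • p) = c * f p
  add_le_apply_add : ∀ ⦃p⦄, p ∈ s → ∀ ⦃q⦄, q ∈ s → f p + f q ≤ f (p + q)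

namespace SuperlinearOn

section Derivative

variable {E : Type*} [NormedAddCommGroup E] [NormedSpace ℝ E] {s : Set E} {f : E → ℝ}
  {f' : E →L[ℝ] ℝ} {p q : E}

theorem le_of_hasFDerivWithinAt (hf : SuperlinearOn s f) (hp : p ∈ s) (hq : q ∈ s)
    (hf' : HasFDerivWithinAt f f' s p) : f q ≤ f' q := by
  have hslope := tendsto_slope_ray_of_hasFDerivWithinAt hf' fun t ht =>
    hf.add_mem hp (hf.smul_mem ht hq)
  refine ge_of_tendsto hslope ?_
  filter_upwards [self_mem_nhdsWithin] with t (ht : 0 < t)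
  have hadd := hf.add_le_apply_add hp (hf.smul_mem ht hq)
  rw [hf.apply_smul ht hq] at hadd
  rw [smul_eq_mul, le_inv_mul_iff₀ ht]
  linarith

theorem apply_self_of_hasFDerivWithinAt (hf : SuperlinearOn s f) (hp : p ∈ s)
    (hf' : HasFDerivWithinAt f f' s p) : f' p = f p := by
  have hslope := tendsto_slope_ray_of_hasFDerivWithinAt hf' fun t ht =>
    hf.add_mem hp (hf.smul_mem ht hp)
  refine tendsto_nhds_unique hslope (tendsto_const_nhds.congr' ?_)
  filter_upwards [self_mem_nhdsWithin] with t (ht : 0 < t)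
  have hray : p + t • p = (1 + t) • p := by rw [add_smul, one_smul]
  rw [hray, hf.apply_smul (by positivity) hp, smul_eq_mul]
  field_simp
  ring

end Derivative

section Orthant

variable {ι : Type*} [Fintype ι] {f : (ι → ℝ) → ℝ} {L : NNReal} {p q : ι → ℝ}

theorem le_add_mul_dist_of_pos (hf : SuperlinearOn (Ici 0) f)
    (hgrad : ∀ p ∈ stdSimplex ℝ ι, (∀ i, 0 < p i) →
      ∃ f' : (ι → ℝ) →L[ℝ] ℝ, HasFDerivWithinAt f f' (Ici 0) p ∧ ‖f'‖ ≤ L)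
    (hp : 0 ≤ p) (hq : ∀ i, 0 < q i) : f p ≤ f q + L * dist p q := by
  obtain hι | hι := isEmpty_or_nonempty ι
  · simp [Subsingleton.elim p q]
  have hsum : 0 < ∑ i, q i := Finset.sum_pos (fun i _ => hq i) Finset.univ_nonempty
  set r := (∑ i, q i)⁻¹ • q
  have hqr : q = (∑ i, q i) • r := (smul_inv_smul₀ hsum.ne' q).symm
  have hr : ∀ i, 0 < r i := fun i => mul_pos (inv_pos.2 hsum) (hq i)
  have hr_simplex : r ∈ stdSimplex ℝ ι :=
    ⟨fun i => (hr i).le, by simp [r, ← Finset.mul_sum, hsum.ne']⟩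
  obtain ⟨f', hf', hnorm⟩ := hgrad r hr_simplex hr
  have hfq : f' q = f q := by
    rw [hqr, map_smul, hf.apply_self_of_hasFDerivWithinAt hr_simplex.1 hf',
      hf.apply_smul hsum hr_simplex.1, smul_eq_mul]
  calc f p ≤ f' p := hf.le_of_hasFDerivWithinAt hr_simplex.1 hp hf'
    _ = f q + f' (p - q) := by rw [map_sub, hfq]; ring
    _ ≤ f q + L * dist p q := by
      rw [dist_eq_norm]
      gcongr
      exact (le_abs_self _).trans (f'.le_of_opNorm_le hnorm _)

theorem lipschitzOnWith (hf : SuperlinearOn (Ici 0) f) (husc : UpperSemicontinuousOn f (Ici 0))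
    (hgrad : ∀ p ∈ stdSimplex ℝ ι, (∀ i, 0 < p i) →
      ∃ f' : (ι → ℝ) →L[ℝ] ℝ, HasFDerivWithinAt f f' (Ici 0) p ∧ ‖f'‖ ≤ L) :
    LipschitzOnWith L f (Ici 0) := by
  refine LipschitzOnWith.of_le_add_mul L fun p hp q hq => ?_
  have hpath : Tendsto (fun t : ℝ => q + t • (1 : ι → ℝ)) (𝓝[>] 0) (𝓝 q) := by
    have hcont : Continuous fun t : ℝ => q + t • (1 : ι → ℝ) := by fun_prop
    simpa using (hcont.tendsto 0).mono_left nhdsWithin_le_nhds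
  have hpos : ∀ t : ℝ, 0 < t → ∀ i, 0 < (q + t • (1 : ι → ℝ)) i := fun t ht i => by
    simpa using add_pos_of_nonneg_of_pos (hq i) ht
  have hpath_mem : ∀ᶠ t : ℝ in 𝓝[>] 0, q + t • (1 : ι → ℝ) ∈ Ici 0 := by
    filter_upwards [self_mem_nhdsWithin] with t ht
    exact fun i => (hpos t ht i).le
  refine sub_le_iff_le_add.1 (le_of_forall_gt_imp_ge_of_dense fun c hc => sub_le_iff_le_add.2 ?_)
  refine ge_of_tendsto ((tendsto_const_nhds.dist hpath).const_mul (L : ℝ) |>.const_add c) ?_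
  filter_upwards [self_mem_nhdsWithin,
    (tendsto_nhdsWithin_iff.2 ⟨hpath, hpath_mem⟩).eventually (husc q hq c hc)] with t ht hfc
  exact (hf.le_add_mul_dist_of_pos hgrad hp (hpos t ht)).trans (by gcongr)

end Orthant

end SuperlinearOn

theorem opNorm_le_card_mul_of_abs_apply_single_le {ι : Type*} [Fintype ι] [DecidableEq ι]
    {f : (ι → ℝ) →L[ℝ] ℝ} {M : ℝ} (hM : 0 ≤ M) (hf : ∀ i, |f (Pi.single i 1)| ≤ M) :
    ‖f‖ ≤ Fintype.card ι * M := by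
  refine f.opNorm_le_bound (by positivity) fun v => ?_
  have hexpand : f v = ∑ i, v i * f (Pi.single i 1) := by
    conv_lhs => rw [pi_eq_sum_univ' v]
    simp only [map_sum, map_smul, smul_eq_mul]
  calc ‖f v‖ ≤ ∑ i, ‖v i * f (Pi.single i 1)‖ := hexpand ▸ norm_sum_le _ _
    _ ≤ ∑ _i : ι, ‖v‖ * M := by
      refine Finset.sum_le_sum fun i _ => ?_
      rw [norm_mul]
      exact mul_le_mul (norm_le_pi_norm v i) (hf i) (abs_nonneg _) (norm_nonneg v)
    _ = Fintype.card ι * M * ‖v‖ := by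
      rw [Finset.sum_const, Finset.card_univ, nsmul_eq_mul]
      ring

namespace BanditModel

variable {K d : ℕ} {Ans : Type*} {B : BanditModel K d Ans} {θ : EuclideanSpace ℝ (Fin d)}

theorem information_nonneg {p : Fin K → ℝ} (hp : p ∈ SelfPlay.orthant K)
    (ϑ : EuclideanSpace ℝ (Fin d)) : 0 ≤ B.information θ p ϑ :=
  Finset.sum_nonneg fun i _ => mul_nonneg (hp i) ENNReal.toReal_nonneg

theorem information_add (p q : Fin K → ℝ) (ϑ : EuclideanSpace ℝ (Fin d)) :
    B.information θ (p + q) ϑ = B.information θ p ϑ + B.information θ q ϑ := by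
  simp [information, add_mul, Finset.sum_add_distrib]

theorem information_smul (c : ℝ) (p : Fin K → ℝ) (ϑ : EuclideanSpace ℝ (Fin d)) :
    B.information θ (c • p) ϑ = c * B.information θ p ϑ := by
  simp [information, Finset.mul_sum, mul_assoc]

theorem continuous_information (ϑ : EuclideanSpace ℝ (Fin d)) :
    Continuous fun p => B.information θ p ϑ := by
  unfold information
  fun_prop

variable {X : Type*} [Fintype X] {A : B.AltDecomposition θ X}

theorem scenarioPayoff_le {p : Fin K → ℝ} (hp : p ∈ SelfPlay.orthant K) {x : X}
    {ϑ : EuclideanSpace ℝ (Fin d)} (hϑ : ϑ ∈ A.alt x) :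
    B.scenarioPayoff θ A p x ≤ B.information θ p ϑ :=
  csInf_le ⟨0, forall_mem_image.2 fun ϑ _ => information_nonneg hp ϑ⟩ (mem_image_of_mem _ hϑ)

theorem le_scenarioPayoff {p : Fin K → ℝ} {x : X} {c : ℝ}
    (hc : ∀ ϑ ∈ A.alt x, c ≤ B.information θ p ϑ) : c ≤ B.scenarioPayoff θ A p x :=
  le_csInf ((A.alt_nonempty x).image _) (forall_mem_image.2 hc)

theorem scenarioPayoff_smul {c : ℝ} (hc : 0 < c) {p : Fin K → ℝ} (hp : p ∈ SelfPlay.orthant K)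
    (x : X) : B.scenarioPayoff θ A (c • p) x = c * B.scenarioPayoff θ A p x := by
  have hcp : c • p ∈ SelfPlay.orthant K := fun i => mul_nonneg hc.le (hp i)
  apply le_antisymm
  · rw [← div_le_iff₀' hc]
    refine le_scenarioPayoff fun ϑ hϑ => ?_
    rw [div_le_iff₀' hc, ← information_smul]
    exact scenarioPayoff_le hcp hϑ
  · refine le_scenarioPayoff fun ϑ hϑ => ?_
    rw [information_smul]
    exact mul_le_mul_of_nonneg_left (scenarioPayoff_le hp hϑ) hc.le

theorem superlinearOn_scenarioPayoff (x : X) :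
    SuperlinearOn (SelfPlay.orthant K) fun p => B.scenarioPayoff θ A p x where
  smul_mem _ hc _ hp := fun i => mul_nonneg hc.le (hp i)
  add_mem _ hp _ hq := fun i => add_nonneg (hp i) (hq i)
  apply_smul _ hc _ hp := scenarioPayoff_smul hc hp x
  add_le_apply_add _ hp _ hq := le_scenarioPayoff fun ϑ hϑ => by
    rw [information_add]
    exact add_le_add (scenarioPayoff_le hp hϑ) (scenarioPayoff_le hq hϑ)

theorem upperSemicontinuousOn_scenarioPayoff (x : X) :
    UpperSemicontinuousOn (fun p => B.scenarioPayoff θ A p x) (SelfPlay.orthant K) := by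
  intro p _ c hc
  obtain ⟨_, ⟨ϑ, hϑ, rfl⟩, hlt⟩ := exists_lt_of_csInf_lt ((A.alt_nonempty x).image _) hc
  filter_upwards [self_mem_nhdsWithin, nhdsWithin_le_nhds
    ((continuous_information ϑ).continuousAt.eventually_lt_const hlt)] with q hq hqc
  exact (scenarioPayoff_le hq hϑ).trans_lt hqc

end BanditModel

theorem SelfPlay.SmoothInside.differentiableAt {K : ℕ} {X : Type*} [Fintype X]
    {D : (Fin K → ℝ) → X → ℝ} (hD : SelfPlay.SmoothInside D) {p : Fin K → ℝ}
    (hp : p ∈ stdSimplex ℝ (Fin K)) (hpos : ∀ i, 0 < p i) (x : X) :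
    DifferentiableAt ℝ (fun p' => D p' x) p := by
  classical
  have hpayoff : (fun p' => D p' x) =
      SelfPlay.payoff D ∘ fun p' => (p', (Pi.single x 1 : X → ℝ)) := by
    ext p'
    simp [SelfPlay.payoff, Pi.single_apply]
  rw [hpayoff]
  exact ((hD (p, Pi.single x 1) ⟨hp, single_mem_stdSimplex ℝ x⟩ hpos).differentiableAt
    two_ne_zero).comp p (by fun_prop)

theorem BanditModel.exists_lipschitzOnWith_scenarioPayoff {K d : ℕ} {Ans : Type*}
    {B : BanditModel K d Ans} {θ : EuclideanSpace ℝ (Fin d)} {X : Type*} [Fintype X]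
    {A : B.AltDecomposition θ X} (hgrad : SelfPlay.BoundedGradients (B.scenarioPayoff θ A))
    (hsmooth : SelfPlay.SmoothInside (B.scenarioPayoff θ A)) :
    ∃ L : NNReal, ∀ x,
      LipschitzOnWith L (fun p => B.scenarioPayoff θ A p x) (SelfPlay.orthant K) := by
  obtain ⟨M, hM⟩ := hgrad
  refine ⟨Fintype.card (Fin K) * M.toNNReal, fun x =>
    (superlinearOn_scenarioPayoff x).lipschitzOnWith (upperSemicontinuousOn_scenarioPayoff x)
      fun p hp hpos => ?_⟩
  have hdiff : DifferentiableWithinAt ℝ (fun p' => B.scenarioPayoff θ A p' x)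
      (SelfPlay.orthant K) p := (hsmooth.differentiableAt hp hpos x).differentiableWithinAt
  refine ⟨_, hdiff.hasFDerivWithinAt, ?_⟩
  rw [NNReal.coe_mul, NNReal.coe_natCast]
  exact opNorm_le_card_mul_of_abs_apply_single_le M.toNNReal.coe_nonneg fun i =>
    (hM x p hp hdiff i).trans M.le_coe_toNNReal

theorem pi_norm_le_sum_norm {ι : Type*} [Fintype ι] (v : ι → ℝ) : ‖v‖ ≤ ∑ i, ‖v i‖ :=
  (pi_norm_le_iff_of_nonneg (by positivity)).2 fun i =>
    Finset.single_le_sum (f := fun i => ‖v i‖) (fun _ _ => norm_nonneg _) (Finset.mem_univ i)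

namespace SelfPlay

variable {K : ℕ} {X : Type*} [Fintype X]

theorem isCompact_stateSpace : IsCompact (stateSpace K X) :=
  (isCompact_stdSimplex ℝ (Fin K)).prod (isCompact_stdSimplex ℝ X)

theorem l1_nonneg (v : (Fin K → ℝ) × (X → ℝ)) : 0 ≤ l1 v := by
  unfold l1
  positivity

theorem continuous_l1 : Continuous (l1 : (Fin K → ℝ) × (X → ℝ) → ℝ) := by
  unfold l1
  fun_prop

theorem norm_le_l1 (v : (Fin K → ℝ) × (X → ℝ)) : ‖v‖ ≤ l1 v :=
  max_le ((pi_norm_le_sum_norm v.1).trans (le_add_of_nonneg_right (by positivity)))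
    ((pi_norm_le_sum_norm v.2).trans (le_add_of_nonneg_left (by positivity)))

theorem l1_le_norm (v : (Fin K → ℝ) × (X → ℝ)) : l1 v ≤ (K + Fintype.card X) * ‖v‖ := by
  have hfst : ∑ i, ‖v.1 i‖ ≤ K * ‖v‖ := by
    simpa using (Pi.sum_norm_apply_le_norm v.1).trans (nsmul_le_nsmul_right (norm_fst_le v) _)
  have hsnd : ∑ x, ‖v.2 x‖ ≤ Fintype.card X * ‖v‖ := by
    simpa using (Pi.sum_norm_apply_le_norm v.2).trans (nsmul_le_nsmul_right (norm_snd_le v) _)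
  rw [add_mul]
  exact add_le_add hfst hsnd

variable {D : (Fin K → ℝ) → X → ℝ}

theorem gradMu_apply [DecidableEq X] (z : (Fin K → ℝ) × (X → ℝ)) (x : X) :
    gradMu D z x = D z.1 x := by
  let f : (X → ℝ) →L[ℝ] ℝ := ∑ x, D z.1 x • ContinuousLinearMap.proj x
  have hf : (fun ν : X → ℝ => payoff D (z.1, ν)) = f := by
    ext ν
    simp [payoff, f, mul_comm]
  rw [gradMu, hf, f.fderiv]
  simp [f, Pi.single_apply]

theorem lipschitzOnWith_payoff {L : NNReal}
    (hD : ∀ x, LipschitzOnWith L (fun p => D p x) (orthant K)) {μ : X → ℝ}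
    (hμ : μ ∈ stdSimplex ℝ X) : LipschitzOnWith L (fun p => payoff D (p, μ)) (orthant K) := by
  refine LipschitzOnWith.of_dist_le_mul fun p hp q hq => ?_
  calc dist (∑ x, μ x * D p x) (∑ x, μ x * D q x)
      ≤ ∑ x, dist (μ x * D p x) (μ x * D q x) := dist_sum_sum_le _ _ _
    _ = ∑ x, μ x * dist (D p x) (D q x) := by
      refine Finset.sum_congr rfl fun x _ => ?_
      rw [Real.dist_eq, Real.dist_eq, ← mul_sub, abs_mul, abs_of_nonneg (hμ.1 x)]
    _ ≤ ∑ x, μ x * (L * dist p q) := Finset.sum_le_sum fun x _ =>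
      mul_le_mul_of_nonneg_left ((hD x).dist_le_mul p hp q hq) (hμ.1 x)
    _ = L * dist p q := by rw [← Finset.sum_mul, hμ.2, one_mul]

theorem norm_gradP_le {L : NNReal} (hD : ∀ x, LipschitzOnWith L (fun p => D p x) (orthant K))
    {z : (Fin K → ℝ) × (X → ℝ)} (hz : z ∈ diffSet D) : ‖gradP D z‖ ≤ L := by
  obtain ⟨p, μ⟩ := z
  obtain ⟨⟨hp, hμ⟩, hdiff⟩ := hz
  refine (pi_norm_le_iff_of_nonneg L.coe_nonneg).2 fun i => ?_
  have hray : ∀ t : ℝ, 0 < t → p + t • (Pi.single i 1 : Fin K → ℝ) ∈ orthant K := fun t ht =>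
    add_nonneg (a := p) hp.1 (smul_nonneg ht.le (Pi.single_nonneg.2 zero_le_one))
  refine le_of_tendsto (tendsto_slope_ray_of_hasFDerivWithinAt hdiff.hasFDerivWithinAt
    (v := (Pi.single i 1, 0)) fun t ht => ⟨hray t ht, mem_univ _⟩).norm ?_
  filter_upwards [self_mem_nhdsWithin] with t (ht : 0 < t)
  have hlip := (lipschitzOnWith_payoff hD hμ).dist_le_mul _ (hray t ht) _ hp.1
  rw [dist_self_add_left, norm_smul, Pi.norm_single, norm_one, mul_one, dist_eq_norm] at hlip
  rw [norm_smul, norm_inv, inv_mul_le_iff₀ (norm_pos_iff.2 ht.ne'), mul_comm]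
  simpa using hlip

/-- The closure of the graph of `∇_p F` over the points of differentiability. Its sections are the
sets of limits of gradients whose convex hulls are the Clarke generalized gradients. -/
def gradGraph (D : (Fin K → ℝ) → X → ℝ) : Set (((Fin K → ℝ) × (X → ℝ)) × (Fin K → ℝ)) :=
  closure ((fun z => (z, gradP D z)) '' diffSet D)

theorem isCompact_gradGraph {L : NNReal}
    (hD : ∀ x, LipschitzOnWith L (fun p => D p x) (orthant K)) : IsCompact (gradGraph D) := by
  refine (isCompact_stateSpace.prod (isCompact_closedBall 0 (L : ℝ))).closure_of_subset ?_
  rintro _ ⟨z, hz, rfl⟩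
  exact ⟨hz.1, mem_closedBall_zero_iff.2 (norm_gradP_le hD hz)⟩

theorem clarkeP_eq_convexHull_gradGraph (z : (Fin K → ℝ) × (X → ℝ)) :
    clarkeP D z = convexHull ℝ (Prod.mk z ⁻¹' gradGraph D) := by
  rw [clarkeP]
  congr 1
  ext f
  rw [mem_preimage, gradGraph, mem_closure_iff_seq_limit]
  constructor
  · rintro ⟨u, hu, hz, hf⟩
    exact ⟨_, fun n => ⟨u n, hu n, rfl⟩, hz.prodMk_nhds hf⟩
  · rintro ⟨w, hw, hlim⟩
    choose u hu huw using hw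
    obtain rfl : (fun n => (u n, gradP D (u n))) = w := funext huw
    exact ⟨u, hu, (continuous_fst.tendsto _).comp hlim, (continuous_snd.tendsto _).comp hlim⟩

theorem isCompact_graph_clarkeP {L : NNReal}
    (hD : ∀ x, LipschitzOnWith L (fun p => D p x) (orthant K)) :
    IsCompact {w : ((Fin K → ℝ) × (X → ℝ)) × (Fin K → ℝ) | w.2 ∈ clarkeP D w.1} := by
  simp only [clarkeP_eq_convexHull_gradGraph]
  exact isCompact_graph_convexHull (isCompact_gradGraph hD)

theorem isCompact_graph_lmoP {L : NNReal}
    (hD : ∀ x, LipschitzOnWith L (fun p => D p x) (orthant K)) :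
    IsCompact {w : ((Fin K → ℝ) × (X → ℝ)) × (Fin K → ℝ) | w.2 ∈ lmoP D w.1} := by
  have hlmo : ∀ z, lmoP D z = convexHull ℝ (Prod.mk z ⁻¹'
      {w | ∃ f ∈ clarkeP D w.1, w.2 ∈ linearArgmax (stdSimplex ℝ (Fin K)) f}) := fun z => by
    rw [lmoP]
    congr 1
    ext q
    exact ⟨fun ⟨hq, f, hf, hmax⟩ => ⟨f, hf, hq, hmax⟩, fun ⟨f, hf, hq, hmax⟩ => ⟨hq, f, hf, hmax⟩⟩
  simp only [hlmo]
  exact isCompact_graph_convexHull (isCompact_graph_linearArgmax_comp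
    (isCompact_graph_clarkeP hD) (isCompact_stdSimplex ℝ (Fin K)))

theorem prodMk_preimage_graph {Y : Type*} {H : (Fin K → ℝ) × (X → ℝ) → Set Y}
    {z : (Fin K → ℝ) × (X → ℝ)} (hz : z ∈ stateSpace K X) : Prod.mk z ⁻¹' graph H = H z := by
  ext y
  simp [graph, hz]

section Drift

variable [DecidableEq X]

theorem continuousOn_gradMu (hD : ∀ x, ContinuousOn (fun p => D p x) (orthant K)) :
    ContinuousOn (gradMu D) (stateSpace K X) := by
  refine continuousOn_pi.2 fun x => ?_
  simp only [gradMu_apply]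
  exact (hD x).comp continuous_fst.continuousOn fun z hz => hz.1.1

theorem lmoMu_eq_linearArgmax (z : (Fin K → ℝ) × (X → ℝ)) :
    lmoMu D z = linearArgmax (stdSimplex ℝ X) (-gradMu D z) := by
  ext ν
  simp [lmoMu, linearArgmax]

theorem isCompact_graph_lmoMu (hD : ∀ x, ContinuousOn (fun p => D p x) (orthant K)) :
    IsCompact (graph (lmoMu D)) := by
  have hgrad : IsCompact ((fun z => (z, -gradMu D z)) '' stateSpace K X) :=
    isCompact_stateSpace.image_of_continuousOn (continuousOn_id.prodMk (continuousOn_gradMu hD).neg)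
  convert isCompact_graph_linearArgmax_comp hgrad (isCompact_stdSimplex ℝ X)
  ext ⟨z, ν⟩
  constructor
  · rintro ⟨hz, hν⟩
    exact ⟨_, ⟨z, hz, rfl⟩, lmoMu_eq_linearArgmax z ▸ hν⟩
  · rintro ⟨_, ⟨z, hz, ⟨⟩⟩, hν⟩
    exact ⟨hz, lmoMu_eq_linearArgmax (D := D) z ▸ hν⟩

theorem isCompact_graph_drift {L : NNReal}
    (hD : ∀ x, LipschitzOnWith L (fun p => D p x) (orthant K)) : IsCompact (graph (drift D)) := by
  let R := {w : ((Fin K → ℝ) × (X → ℝ)) × (Fin K → ℝ) | w.2 ∈ lmoP D w.1} ×ˢ graph (lmoMu D)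
  have hR : IsCompact (R ∩ {u | u.1.1 = u.2.1}) :=
    ((isCompact_graph_lmoP hD).prod
      (isCompact_graph_lmoMu fun x => (hD x).continuousOn)).inter_right
        (isClosed_eq (by fun_prop) (by fun_prop))
  convert hR.image (f := fun u => (u.1.1, (u.1.2 - u.1.1.1, u.2.2 - u.1.1.2))) (by fun_prop)
  ext ⟨z, y⟩
  constructor
  · rintro ⟨hz, q, hq, ν, hν, hy⟩
    exact ⟨((z, q), (z, ν)), ⟨⟨hq, hz, hν⟩, rfl⟩, Prod.ext rfl hy.symm⟩
  · rintro ⟨⟨⟨z, q⟩, ⟨_, ν⟩⟩, ⟨⟨hq, hz, hν⟩, ⟨⟩⟩, ⟨⟩⟩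
    exact ⟨hz, q, hq, ν, hν, rfl⟩

theorem convex_drift (z : (Fin K → ℝ) × (X → ℝ)) : Convex ℝ (drift D z) := by
  have hlmo : Convex ℝ (lmoP D z ×ˢ lmoMu D z) := by
    rw [lmoMu_eq_linearArgmax]
    exact (convex_convexHull ℝ _).prod (convex_linearArgmax (convex_stdSimplex ℝ X) _)
  suffices htranslate : drift D z = (fun w => -z + w) '' (lmoP D z ×ˢ lmoMu D z) from
    htranslate ▸ hlmo.translate (-z)
  ext y
  constructor
  · rintro ⟨q, hq, ν, hν, rfl⟩
    exact ⟨(q, ν), ⟨hq, hν⟩, neg_add_eq_sub z (q, ν)⟩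
  · rintro ⟨⟨q, ν⟩, ⟨hq, hν⟩, rfl⟩
    exact ⟨q, hq, ν, hν, neg_add_eq_sub z (q, ν)⟩

theorem convex_prodMk_preimage_graph_drift (z : (Fin K → ℝ) × (X → ℝ)) :
    Convex ℝ (Prod.mk z ⁻¹' graph (drift D)) := by
  by_cases hz : z ∈ stateSpace K X
  · rw [prodMk_preimage_graph hz]
    exact convex_drift z
  · convert convex_empty (𝕜 := ℝ)
    ext y
    simp [graph, hz]

theorem exists_mem_graph_drift_of_mem_perturbedDrift (hG : IsCompact (graph (drift D))) {ε : ℝ}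
    (hε : 0 ≤ ε) {z y : (Fin K → ℝ) × (X → ℝ)} (hy : y ∈ perturbedDrift D ε z) :
    ∃ w ∈ graph (drift D), l1 (z - w.1) + l1 (y - w.2) ≤ ε := by
  obtain ⟨z', hz', hdist⟩ := hy
  obtain hempty | hne := (drift D z').eq_empty_or_nonempty
  · simp [l1Dist, hempty] at hdist
  have hcompact : IsCompact (drift D z') :=
    prodMk_preimage_graph (H := drift D) hz' ▸ isCompact_prodMk_preimage hG z'
  obtain ⟨y', hy', hmin⟩ := hcompact.exists_isMinOn hne
    (f := fun a => l1 (y - a)) (continuous_l1.comp (by fun_prop)).continuousOn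
  have hle : ENNReal.ofReal (l1 (y - y')) ≤ l1Dist y (drift D z') :=
    le_iInf₂ fun a ha => ENNReal.ofReal_le_ofReal (hmin ha)
  refine ⟨(z', y'), ⟨hz', hy'⟩, (ENNReal.ofReal_le_ofReal_iff hε).1 ?_⟩
  rw [ENNReal.ofReal_add (l1_nonneg _) (l1_nonneg _)]
  exact (add_le_add_right hle _).trans hdist

theorem prodMk_mem_cthickening_graph_drift (hG : IsCompact (graph (drift D))) {ε : ℝ}
    (hε : 0 ≤ ε) {z y : (Fin K → ℝ) × (X → ℝ)} (hy : y ∈ perturbedDrift D ε z) :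
    (z, y) ∈ Metric.cthickening ε (graph (drift D)) := by
  obtain ⟨w, hw, hle⟩ := exists_mem_graph_drift_of_mem_perturbedDrift hG hε hy
  refine Metric.mem_cthickening_of_dist_le _ w ε _ hw ?_
  rw [dist_eq_norm]
  exact max_le
    ((norm_le_l1 (z - w.1)).trans ((le_add_of_nonneg_right (l1_nonneg _)).trans hle))
    ((norm_le_l1 (y - w.2)).trans ((le_add_of_nonneg_left (l1_nonneg _)).trans hle))

theorem mem_perturbedDrift_zero {z y : (Fin K → ℝ) × (X → ℝ)}
    (hzy : (z, y) ∈ graph (drift D)) : y ∈ perturbedDrift D 0 z := by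
  have hdist : l1Dist y (drift D z) ≤ ENNReal.ofReal (l1 (y - y)) := iInf₂_le y hzy.2
  exact ⟨z, hzy.1, by simpa [l1] using hdist⟩

variable {T : ℝ} {z₀ : (Fin K → ℝ) × (X → ℝ)} {z : ℝ → (Fin K → ℝ) × (X → ℝ)}

theorem isInclusionSolution_of_mem_solutions (hG : IsCompact (graph (drift D))) {ε : ℝ}
    (hε : 0 ≤ ε) (hz : z ∈ solutions D ε T z₀) :
    IsInclusionSolution (Metric.cthickening ε (graph (drift D))) (stateSpace K X) 0 T z where
  mapsTo := hz.2.1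
  absolutelyContinuous := hz.2.2.1
  exists_hasDerivAt := by
    filter_upwards [(ae_restrict_iff' measurableSet_Icc).1 hz.2.2.2] with t ht htT
    obtain ⟨y, hy, hderiv⟩ := ht htT
    exact ⟨y, prodMk_mem_cthickening_graph_drift hG hε hy, hderiv⟩

theorem mem_solutions_of_isInclusionSolution
    (hz : IsInclusionSolution (graph (drift D)) (stateSpace K X) 0 T z) :
    z ∈ solutions D 0 T (z 0) := by
  refine ⟨rfl, hz.mapsTo, hz.absolutelyContinuous, (ae_restrict_iff' measurableSet_Icc).2 ?_⟩
  filter_upwards [hz.exists_hasDerivAt] with t ht htT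
  obtain ⟨y, hy, hderiv⟩ := ht htT
  exact ⟨y, mem_perturbedDrift_zero hy, hderiv⟩

theorem exists_mem_graph_solutions_l1_le (hG : IsCompact (graph (drift D))) {δ : ℝ} (hδ : 0 < δ)
    (hT : 0 ≤ T) :
    ∃ ε : ℝ, 0 < ε ∧ ∀ w ∈ graph (solutions D ε T), ∃ w' ∈ graph (solutions D 0 T),
      ∀ t ∈ Icc 0 T, l1 (w.1 - w'.1) + l1 (w.2 t - w'.2 t) ≤ δ := by
  set C : ℝ := K + Fintype.card X
  have : 0 ≤ C := by positivity
  obtain ⟨ε, hε, hclose⟩ := exists_isInclusionSolution_dist_lt_of_cthickening hG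
    convex_prodMk_preimage_graph_drift isCompact_stateSpace hT
    (show 0 < δ / (2 * (C + 1)) by positivity)
  refine ⟨ε, hε, ?_⟩
  rintro ⟨z₀, z⟩ ⟨-, hz⟩
  obtain ⟨g, hg, hdist⟩ := hclose z (isInclusionSolution_of_mem_solutions hG hε.le hz)
  obtain rfl : z 0 = z₀ := hz.1
  have hl1 : ∀ t ∈ Icc 0 T, l1 (z t - g t) ≤ δ / 2 := fun t ht => by
    have hlt := hdist t ht
    rw [dist_eq_norm, lt_div_iff₀ (by positivity)] at hlt
    linarith [l1_le_norm (z t - g t), norm_nonneg (z t - g t)]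
  have h0 : (0 : ℝ) ∈ Icc 0 T := left_mem_Icc.2 hT
  refine ⟨(g 0, g), ⟨hg.mapsTo h0, mem_solutions_of_isInclusionSolution hg⟩, fun t ht => ?_⟩
  linarith [hl1 0 h0, hl1 t ht]

end Drift

end SelfPlay

open SelfPlay in
theorem proposition3_general {K : ℕ} {X : Type*} [Fintype X] [DecidableEq X]
    {D : (Fin K → ℝ) → X → ℝ} {L : NNReal}
    (hD : ∀ x, LipschitzOnWith L (fun p => D p x) (orthant K)) :
    (∀ ε : ℝ, 0 ≤ ε →
      ∀ w ∈ graph (perturbedDrift D ε),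
        ∃ w' ∈ graph (drift D), l1 (w.1 - w'.1) + l1 (w.2 - w'.2) ≤ ε) ∧
    (∀ δ T : ℝ, 0 < δ → 0 ≤ T → ∃ ε : ℝ, 0 < ε ∧
      ∀ w ∈ graph (solutions D ε T), ∃ w' ∈ graph (solutions D 0 T),
        ∀ t ∈ Icc 0 T, l1 (w.1 - w'.1) + l1 (w.2 t - w'.2 t) ≤ δ) := by
  have hG : IsCompact (graph (drift D)) := isCompact_graph_drift hD
  exact ⟨fun ε hε w hw => exists_mem_graph_drift_of_mem_perturbedDrift hG hε hw.2,
    fun δ T hδ hT => exists_mem_graph_solutions_l1_le hG hδ hT⟩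

open SelfPlay in
theorem proposition3 {K d : ℕ} {Ans : Type*} {X : Type*} [Fintype X] [DecidableEq X]
    (B : BanditModel K d Ans) (θ : EuclideanSpace ℝ (Fin d)) (hθ : θ ∈ B.states)
    (A : B.AltDecomposition θ X)
    (hgrad : BoundedGradients (B.scenarioPayoff θ A))
    (hsmooth : SmoothInside (B.scenarioPayoff θ A)) :
    (∀ ε : ℝ, 0 < ε →
      ∀ w ∈ graph (perturbedDrift (B.scenarioPayoff θ A) ε),
        ∃ w' ∈ graph (drift (B.scenarioPayoff θ A)),
          l1 (w.1 - w'.1) + l1 (w.2 - w'.2) ≤ ε) ∧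
    (∀ δ T : ℝ, 0 < δ → 0 < T → ∃ ε : ℝ, 0 < ε ∧
      ∀ w ∈ graph (solutions (B.scenarioPayoff θ A) ε T),
        ∃ w' ∈ graph (solutions (B.scenarioPayoff θ A) 0 T),
          ∀ t ∈ Set.Icc 0 T, l1 (w.1 - w'.1) + l1 (w.2 t - w'.2 t) ≤ δ) := by
  obtain ⟨L, hL⟩ := BanditModel.exists_lipschitzOnWith_scenarioPayoff hgrad hsmooth
  obtain ⟨hdrift, hsolutions⟩ := proposition3_general hL
  exact ⟨fun ε hε => hdrift ε hε.le, fun δ T hδ hT => hsolutions δ T hδ hT.le⟩
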